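/- Let $B$ be a band, i.e. a semigroup of idempotents, written as a semilattice $Y$ of rectangular bands, $B=\bigcup_{\alpha\in Y}B_\alpha$ (so $x\in B_\alpha$, $y\in B_\beta$ satisfy $\alpha\le\beta$ iff $BxB\subseteq ByB$). Let $$\mathrm{IG}(B)=\langle\, \overline{B} : \bar e\,\bar f=\overline{ef},\ e,f\in B,\ \{e,f\}\cap\{ef,fe\}\neq\emptyset\,\rangle ,\qquad \overline B=\{\bar e: e\in B\},$$ be the free idempotent generated semigroup over $B$. *Definitions.* For a semigroup $S$, $a\,\mathcal R^*\,b$ means that $xa=ya\Leftrightarrow xb=yb$ for all $x,y\in S^1$, and $a\,\mathcal L^*\,b$ is defined dually; $S$ is *abundant* if every $\mathcal R^*$-class and every $\mathcal L^*$-class contains an idempotent. $\mathcal R$ and $\mathcal L$ denote Green's relations on $B$. The band $B$ is *normal* if it satisfies $xyzx=xzyx$, and *locally large* if $uv=vu=u$ whenever $u\in B_\alpha$, $v\in B_\beta$ and $\alpha<\beta$. For a nonempty word $w=\bar x_1\cdots\bar x_n$ with $x_p\in B_{\alpha_p}$, the *left to right significant indices* $i_1<\dots<i_r$ are defined as follows: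 put $k_0=0$; given $k_{s-1}<n$, let $i_s$ be the largest $p$ with $k_{s-1}<p\le n$ such that $\alpha_{k_{s-1}+1},\dots,\alpha_{p}\ge\alpha_{p}$, and let $k_s$ be the largest $m$ with $i_s\le m\le n$ such that $\alpha_{i_s},\dots,\alpha_{m}\ge\alpha_{i_s}$; stop when $k_r=n$. The number $r$ is the *$Y$-length* of $w$. The word $w$ is in *almost normal form* if it splits into $r\ge1$ consecutive nonempty blocks such that all letters of the $s$-th block lie in one component $B_{\beta_s}$, and $\beta_s,\beta_{s+1}$ are incomparable for $1\le s<r$. $\mathrm{IG}(B)$ satisfies *Condition (P)* if, for any two almost normal forms with $\bar u_1\cdots\bar u_n=\bar v_1\cdots\bar v_m$ in $\mathrm{IG}(B)$, of $Y$-length $r$ and with left to right significant indices $i_1,\dots,i_r=n$ and $l_1,\dots,l_r=m$ respectively (and $i_0=l_0=0$): (i) for all $s\in[1,r]$, $u_{i_s}\,\mathcal L\,v_{l_s}$ implies $\bar u_1\cdots\bar u_{i_s}=\bar v_1\cdots\bar v_{l_s}$ in $\mathrm{IG}(B)$; (ii) for all $t\in[0,r-1]$, $u_{i_t+1}\,\mathcal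 R\,v_{l_t+1}$ implies $\bar u_{i_t+1}\cdots\bar u_n=\bar v_{l_t+1}\cdots\bar v_m$ in $\mathrm{IG}(B)$. **Proposition.** (a) Suppose that $\mathrm{IG}(B)$ satisfies Condition (P) and that $B$ is normal or locally large. Then $\mathrm{IG}(B)$ is abundant. Moreover, for every word $\bar x_1\cdots\bar x_n$ in almost normal form, $\bar x_1\cdots\bar x_n\ \mathcal R^*\ \bar x_1$ and $\bar x_1\cdots\bar x_n\ \mathcal L^*\ \bar x_n$ in $\mathrm{IG}(B)$. (b) If $B$ is locally large, then $\mathrm{IG}(B)$ satisfies Condition (P). (c) Consequently, $\mathrm{IG}(B)$ is abundant for every locally large band $B$. -/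

import Mathlib

namespace FreeIG

/-- A band: a semigroup in which every element is idempotent. -/
class Band (B : Type*) extends Semigroup B where
  mul_self : ∀ x : B, x * x = x

section Semigroups

variable {S : Type*} [Semigroup S]

/-- Green's relation `𝓛`: `S¹a = S¹b`. Adjoining a new identity to a semigroup that already has one
does not change this relation. -/
def GreenL (a b : S) : Prop :=
  (Set.range fun x : WithOne S => x * (a : WithOne S)) =
    Set.range fun x : WithOne S => x * (b : WithOne S)

/-- Green's relation `𝓡`: `aS¹ = bS¹`. -/
def GreenR (a b : S) : Prop :=
  (Set.range fun x : WithOne S => (a : WithOne S) * x) =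
    Set.range fun x : WithOne S => (b : WithOne S) * x

/-- The relation `𝓛*`: for all `x, y ∈ S¹`, `ax = ay ↔ bx = by`. Adjoining a new identity to a
semigroup that already has one does not change this relation. -/
def LStar (a b : S) : Prop :=
  ∀ x y : WithOne S, (a : WithOne S) * x = a * y ↔ (b : WithOne S) * x = b * y

/-- The relation `𝓡*`: for all `x, y ∈ S¹`, `xa = ya ↔ xb = yb`. -/
def RStar (a b : S) : Prop :=
  ∀ x y : WithOne S, x * (a : WithOne S) = y * a ↔ x * (b : WithOne S) = y * b

variable (S) in
/-- A semigroup is abundant if every `𝓛*`-class and every `𝓡*`-class contains an idempotent. -/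
def IsAbundant : Prop :=
  ∀ a : S, (∃ e : S, IsIdempotentElem e ∧ LStar a e) ∧ (∃ e : S, IsIdempotentElem e ∧ RStar a e)

end Semigroups

section Presentation

variable (B : Type*) [Band B]

/-- The defining relations `ē f̄ = \overline{ef}`, one for each basic pair `(e, f)`, that is, each
pair with `{e, f} ∩ {ef, fe} ≠ ∅`. -/
inductive BasicRel : FreeSemigroup B → FreeSemigroup B → Prop
  | basic (e f : B) (h : (({e, f} : Set B) ∩ {e * f, f * e}).Nonempty) :
      BasicRel (FreeSemigroup.of e * FreeSemigroup.of f) (FreeSemigroup.of (e * f))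

/-- The free idempotent generated semigroup `IG(B)` over the band `B`. -/
def IG : Type _ := (conGen (BasicRel B)).Quotient

instance : Semigroup (IG B) := inferInstanceAs (Semigroup (conGen (BasicRel B)).Quotient)

variable {B}

/-- The element of `IG(B)` represented by a word of `B⁺`. -/
def IG.mk (w : FreeSemigroup B) : IG B := ((w : (conGen (BasicRel B)).Quotient))

/-- The generator `x̄` of `IG(B)`. -/
def IG.bar (x : B) : IG B := IG.mk (FreeSemigroup.of x)

end Presentation

section Components

variable {B : Type*} [Band B]

/-- The component of `x` in the structure semilattice `Y` of the band `B`. The semilattice `Y` is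
realised as the set of principal ideals `BxB`, ordered by inclusion and with meet the intersection,
and `B_α = {x | comp x = α}`; by the two lemmas below `comp` is a morphism onto `Y` and the `B_α`
are rectangular bands. -/
def comp (x : B) : Set B := {z | ∃ a b : B, z = a * x * b}

theorem comp_mul (x y : B) : comp (x * y) = comp x ∩ comp y := by
  ext z
  constructor
  · rintro ⟨a, b, rfl⟩
    exact ⟨⟨a, y * b, by simp only [mul_assoc]⟩, ⟨a * x, b, by simp only [mul_assoc]⟩⟩
  · rintro ⟨⟨a, b, h1⟩, ⟨c, d, h2⟩⟩
    refine ⟨c * (y * (d * a)), d * a * x * b, ?_⟩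
    have e : y * (d * a) * x = y * (d * a) * (x * y) * (d * a * x) := by
      calc y * (d * a) * x = (y * (d * a) * x) * (y * (d * a) * x) := by rw [Band.mul_self]
        _ = _ := by simp only [mul_assoc]
    calc z = (c * y * d) * (a * x * b) := by rw [← h1, ← h2, Band.mul_self]
      _ = c * (y * (d * a) * x) * b := by simp only [mul_assoc]
      _ = c * (y * (d * a) * (x * y) * (d * a * x)) * b := by rw [← e]
      _ = _ := by simp only [mul_assoc]

theorem comp_eq_iff (x y : B) : comp x = comp y ↔ x * y * x = x ∧ y * x * y = y := by
  have key : ∀ s y : B, s ∈ comp y → s * y * s = s := by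
    rintro s y ⟨a, b, hs⟩
    have h1 : s * y * b = s := by
      calc s * y * b = a * ((y * b) * (y * b)) := by rw [hs]; simp only [mul_assoc]
        _ = s := by rw [Band.mul_self, hs, mul_assoc]
    calc s * y * s = s * y * (s * y * b) := by rw [h1]
      _ = (s * y) * (s * y) * b := by simp only [mul_assoc]
      _ = s := by rw [Band.mul_self, h1]
  have self : ∀ s : B, s ∈ comp s := fun s => ⟨s, s, by simp only [Band.mul_self]⟩
  have tr : ∀ s t : B, s * t * s = s → comp s ⊆ comp t := by
    rintro s t h z ⟨a, b, rfl⟩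
    exact ⟨a * s, s * b, by nth_rw 1 [← h]; simp only [mul_assoc]⟩
  constructor
  · intro h
    exact ⟨key x y (h ▸ self x), key y x (h ▸ self y)⟩
  · rintro ⟨h1, h2⟩
    exact Set.Subset.antisymm (tr x y h1) (tr y x h2)

variable (B) in
/-- A normal band: `xyzx = xzyx` holds identically. -/
def IsNormalBand : Prop := ∀ x y z : B, x * y * z * x = x * z * y * x

variable (B) in
/-- A locally large band: `uv = vu = u` whenever `u ∈ B_α`, `v ∈ B_β` and `α < β`. -/
def IsLocallyLarge : Prop := ∀ u v : B, comp u < comp v → u * v = u ∧ v * u = u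

end Components

section Words

variable {B : Type*} [Band B]

/-- The letter `x_p` of the word `x_1 ⋯ x_n`, for `1 ≤ p ≤ n`. -/
def letter (w : FreeSemigroup B) (p : ℕ) : B := (w.head :: w.tail).getD (p - 1) w.head

/-- The subword `x_a ⋯ x_b` of the word `x_1 ⋯ x_n`, for `1 ≤ a ≤ b ≤ n`. -/
def subword (w : FreeSemigroup B) (a b : ℕ) : FreeSemigroup B :=
  ⟨letter w a, (List.range' (a + 1) (b - a)).map (letter w)⟩

/-- `i 1 < ⋯ < i r` are the left to right significant indices of the word `w = x_1 ⋯ x_n` (so its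
`Y`-length is `r`), with the convention `i 0 = 0`. With `x_p ∈ B_{α_p}` and `k 0 = 0`:
`i (s+1)` is the largest `p` such that `α_{k s + 1}, …, α_p ≥ α_p`, and then
`k (s+1)` is the largest `m` such that `α_{i (s+1)}, …, α_m ≥ α_{i (s+1)}`, until `k r = n`. -/
def IsSignificant (w : FreeSemigroup B) (r : ℕ) (i : ℕ → ℕ) : Prop :=
  i 0 = 0 ∧ ∃ k : ℕ → ℕ, k 0 = 0 ∧ k r = w.length ∧ ∀ s < r,
    IsGreatest {p | k s < p ∧ p ≤ w.length ∧
      ∀ q, k s < q → q ≤ p → comp (letter w p) ≤ comp (letter w q)} (i (s + 1)) ∧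
    IsGreatest {m | i (s + 1) ≤ m ∧ m ≤ w.length ∧
      ∀ q, i (s + 1) ≤ q → q ≤ m → comp (letter w (i (s + 1))) ≤ comp (letter w q)} (k (s + 1))

/-- `w = x_1 ⋯ x_n` is in almost normal form: there are `0 = i 0 < i 1 < ⋯ < i r = n` such that, for
each `s < r`, the letters `x_{i s + 1}, …, x_{i (s+1)}` all lie in the component `B_{α s}`, and
`α s`, `α (s+1)` are incomparable whenever `s + 1 < r`. -/
def IsAlmostNormal (w : FreeSemigroup B) : Prop :=
  ∃ (r : ℕ) (i : ℕ → ℕ) (α : ℕ → Set B), i 0 = 0 ∧ i r = w.length ∧ (∀ s < r, i s < i (s + 1)) ∧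
    (∀ s < r, ∀ p, i s < p → p ≤ i (s + 1) → comp (letter w p) = α s) ∧
    ∀ s, s + 1 < r → ¬ α s ≤ α (s + 1) ∧ ¬ α (s + 1) ≤ α s

variable (B) in
/-- Condition (P) for `IG(B)`. -/
def ConditionP : Prop :=
  ∀ u v : FreeSemigroup B, IsAlmostNormal u → IsAlmostNormal v → IG.mk u = IG.mk v →
    ∀ (r : ℕ) (i l : ℕ → ℕ), IsSignificant u r i → IsSignificant v r l →
      (∀ s, 1 ≤ s → s ≤ r → GreenL (letter u (i s)) (letter v (l s)) →
        IG.mk (subword u 1 (i s)) = IG.mk (subword v 1 (l s))) ∧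
      (∀ t < r, GreenR (letter u (i t + 1)) (letter v (l t + 1)) →
        IG.mk (subword u (i t + 1) u.length) = IG.mk (subword v (l t + 1) v.length))

end Words

end FreeIG

open FreeIG

/-! A word over `B` is read by a stack machine whose levels lie in the semilattice of components. A
basic pair has comparable components, and reading it has the same effect as reading its product, so
the final stack is an invariant of the element of `IG(B)`. A word is in almost normal form exactly
when neighbouring letters have equal or incomparable levels (`Adj`). Reading such a word never pops,
and the stack lists its blocks.

With trivial weights the invariant is the sequence of block levels. If `B` is locally large,
strictly higher letters disappear without trace, so weights in `IG(B)¹` may be used. The stack then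
determines the value of each block (`IsLocallyLarge.split`), which gives Condition (P).

For abundance, every element has an almost normal form (`Reducible.exists_isChain`), so it suffices
to show that such a form is `𝓡*`-related to its first letter and `𝓛*`-related to its last; these
letters are idempotents. The nontrivial half is a cancellation: if `p` and `q` agree after
multiplication by `x :: w`, they agree after multiplication by `x` (`Reducible.mul_right_cancel`).
To prove it, `p x` and `q x` are put in almost normal form; their levels agree by
`run_unit_injective`, and `Reducible.cancel` works through `w`. As long as the letters of `w` are
absorbed, their effect is either trivial (locally large) or the same on both sides and invertible
(normal). At the first incomparable letter a new block starts, and Condition (P) or uniqueness of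
blocks separates the prefixes. The structure `Reducible` isolates what is needed, so that the same
argument in the opposite monoid gives `𝓛*`. -/

namespace FreeIG

/-! ### A stack machine on words over a partially ordered alphabet -/

section Stack

variable {Y N : Type*} [PartialOrder Y] [Mul N]

open Classical in
/-- Read a letter of level `c` and weight `n`: strictly higher levels on top of the stack are
popped, strictly lower levels absorb the letter, and equal levels multiply their weights. -/
noncomputable def push (c : Y) (n : N) : List (Y × N) → List (Y × N)
  | [] => [(c, n)]
  | (a, m) :: s =>
    if c < a then push c n s
    else if a < c then (a, m) :: s
    else if a = c then (a, m * n) :: s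
    else (c, n) :: (a, m) :: s

variable {a c d : Y} {m n n' : N} {s : List (Y × N)}

@[simp] theorem push_nil : push c n [] = [(c, n)] := rfl

theorem push_of_lt (h : c < a) : push c n ((a, m) :: s) = push c n s := by
  simp [push, h]

theorem push_of_gt (h : a < c) : push c n ((a, m) :: s) = (a, m) :: s := by
  simp [push, h, h.not_gt]

theorem push_of_eq : push a n ((a, m) :: s) = (a, m * n) :: s := by
  simp [push]

theorem push_of_incomp (h : ¬ a ≤ c) (h' : ¬ c ≤ a) :
    push c n ((a, m) :: s) = (c, n) :: (a, m) :: s := by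
  have h1 : ¬ c < a := fun h => h' h.le
  have h2 : ¬ a < c := fun h3 => h h3.le
  have h3 : ¬ a = c := fun h3 => h h3.le
  simp [push, h1, h2, h3]

theorem order_cases (a c : Y) : c < a ∨ a < c ∨ a = c ∨ (¬ a ≤ c ∧ ¬ c ≤ a) := by
  by_cases h1 : a ≤ c <;> by_cases h2 : c ≤ a
  · exact Or.inr (Or.inr (Or.inl (le_antisymm h1 h2)))
  · exact Or.inr (Or.inl (lt_of_le_not_ge h1 h2))
  · exact Or.inl (lt_of_le_not_ge h2 h1)
  · exact Or.inr (Or.inr (Or.inr ⟨h1, h2⟩))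

theorem exists_push_eq (c : Y) (n : N) (s : List (Y × N)) :
    ∃ a m t, push c n s = (a, m) :: t ∧ a ≤ c := by
  induction s with
  | nil => exact ⟨c, n, [], rfl, le_rfl⟩
  | cons p s ih =>
    obtain ⟨a, m⟩ := p
    rcases order_cases a c with h | h | h | ⟨h, h'⟩
    · rw [push_of_lt h]; exact ih
    · rw [push_of_gt h]; exact ⟨_, _, _, rfl, h.le⟩
    · subst h; rw [push_of_eq]; exact ⟨_, _, _, rfl, le_rfl⟩
    · rw [push_of_incomp h h']; exact ⟨_, _, _, rfl, le_rfl⟩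

/-- This and the next two lemmas show that two letters of comparable levels act as one letter of the
lower level; hence the machine respects the basic relations. -/
theorem push_push_of_lt (h : c < d) : push d n' (push c n s) = push c n s := by
  obtain ⟨a, m, t, e, ha⟩ := exists_push_eq c n s
  rw [e, push_of_gt (ha.trans_lt h)]

theorem push_push_of_gt (h : d < c) : push d n' (push c n s) = push d n' s := by
  induction s with
  | nil => rw [push_nil, push_of_lt h]
  | cons p s ih =>
    obtain ⟨a, m⟩ := p
    rcases order_cases a c with h1 | h1 | h1 | ⟨h1, h2⟩
    · rw [push_of_lt h1, push_of_lt (h.trans h1), ih]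
    · rw [push_of_gt h1]
    · subst h1; rw [push_of_eq, push_of_lt h, push_of_lt h]
    · rw [push_of_incomp h1 h2, push_of_lt h]

theorem push_push_same {N : Type*} [Semigroup N] {n n' : N} {s : List (Y × N)} :
    push c n' (push c n s) = push c (n * n') s := by
  induction s with
  | nil => rw [push_nil, push_of_eq, push_nil]
  | cons p s ih =>
    obtain ⟨a, m⟩ := p
    rcases order_cases a c with h1 | h1 | h1 | ⟨h1, h2⟩
    · rw [push_of_lt h1, push_of_lt h1, ih]
    · rw [push_of_gt h1, push_of_gt h1, push_of_gt h1]
    · subst h1; rw [push_of_eq, push_of_eq, push_of_eq, mul_assoc]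
    · rw [push_of_incomp h1 h2, push_of_incomp h1 h2, push_of_eq]

/-- Pops and pushes are decided by levels alone, so stacks with different weights can be compared in
length. -/
theorem map_fst_push {N' : Type*} [Mul N'] (n : N) (n' : N') (s : List (Y × N))
    (s' : List (Y × N')) (h : s.map Prod.fst = s'.map Prod.fst) :
    (push c n s).map Prod.fst = (push c n' s').map Prod.fst := by
  induction s generalizing s' with
  | nil =>
    obtain rfl : s' = [] := by simpa using h.symm
    rfl
  | cons p s ih =>
    obtain ⟨a, m⟩ := p
    match s', h with
    | (a', m') :: s', h =>
      simp only [List.map_cons, List.cons.injEq] at h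
      obtain ⟨rfl, h⟩ := h
      rcases order_cases a c with h1 | h1 | h1 | ⟨h1, h2⟩
      · rw [push_of_lt h1, push_of_lt h1, ih s' h]
      · rw [push_of_gt h1, push_of_gt h1]; simp [h]
      · subst h1; rw [push_of_eq, push_of_eq]; simp [h]
      · rw [push_of_incomp h1 h2, push_of_incomp h1 h2]; simp [h]

variable {B : Type*} (c : B → Y) (π : B → N)

/-- Read a word from left to right. -/
noncomputable def run (s : List (Y × N)) (w : List B) : List (Y × N) :=
  w.foldl (fun s x => push (c x) (π x) s) s

@[simp] theorem run_nil (s : List (Y × N)) : run c π s [] = s := rfl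

@[simp] theorem run_cons (s : List (Y × N)) (x : B) (w : List B) :
    run c π s (x :: w) = run c π (push (c x) (π x) s) w := rfl

theorem run_append (s : List (Y × N)) (u v : List B) :
    run c π s (u ++ v) = run c π (run c π s u) v := by
  simp [run]

theorem run_concat (s : List (Y × N)) (u : List B) (x : B) :
    run c π s (u ++ [x]) = push (c x) (π x) (run c π s u) := by
  simp [run]

theorem map_fst_run {N' : Type*} [Mul N'] (π' : B → N') (w : List B) :
    (run c π [] w).map Prod.fst = (run c π' [] w).map Prod.fst := by
  induction w using List.reverseRecOn with
  | nil => rfl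
  | append_singleton w x ih => rw [run_concat, run_concat]; exact map_fst_push _ _ _ _ ih

/-- Letters that may be neighbours in an almost normal form. -/
def Adj (x y : B) : Prop := c x = c y ∨ (¬ c x ≤ c y ∧ ¬ c y ≤ c x)

variable {c}

theorem Adj.symm {x y : B} (h : Adj c x y) : Adj c y x :=
  h.imp Eq.symm And.symm

theorem Adj.incomp {x y : B} (h : Adj c x y) (hne : c x ≠ c y) : ¬ c x ≤ c y ∧ ¬ c y ≤ c x :=
  h.resolve_left hne

theorem Adj.eq_of_le {x y : B} (h : Adj c x y) (hle : c x ≤ c y) : c x = c y :=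
  h.resolve_right fun h => h.1 hle

theorem isChain_concat_concat {w : List B} {x y : B} (h : List.IsChain (Adj c) (w ++ [x]))
    (hxy : Adj c x y) : List.IsChain (Adj c) (w ++ [x] ++ [y]) := by
  rw [List.isChain_append]
  refine ⟨h, by simp, ?_⟩
  intro a ha b hb
  simp at ha hb
  subst ha; subst hb; exact hxy

theorem adj_of_isChain {u w : List B} {x y : B} (h : List.IsChain (Adj c) (u ++ x :: y :: w)) :
    Adj c x y := by
  have := (List.isChain_append.1 h).2.1
  exact (List.isChain_cons_cons.1 this).1

theorem isChain_left {u w : List B} {x : B} (h : List.IsChain (Adj c) (u ++ x :: w)) :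
    List.IsChain (Adj c) (u ++ [x]) := by
  have h' : List.IsChain (Adj c) ((u ++ [x]) ++ w) := by simpa using h
  exact (List.isChain_append.1 h').1

theorem isChain_right {u w : List B} (h : List.IsChain (Adj c) (u ++ w)) :
    List.IsChain (Adj c) w := (List.isChain_append.1 h).2.1

theorem isChain_glue {u w : List B} {x y : B} (h : List.IsChain (Adj c) (u ++ [x]))
    (h' : List.IsChain (Adj c) (y :: w)) (hxy : Adj c x y) :
    List.IsChain (Adj c) (u ++ x :: y :: w) := by
  have : List.IsChain (Adj c) ((u ++ [x]) ++ y :: w) := by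
    rw [List.isChain_append]
    refine ⟨h, h', ?_⟩
    intro a ha b hb
    simp at ha hb
    subst ha; subst hb; exact hxy
  simpa using this

/-- In an almost normal form, a new block starts a new entry of the stack and a repeated level
updates the top entry. -/
theorem push_of_adj {x y : B} {m n : N} {s : List (Y × N)} (h : Adj c x y) :
    (c x = c y ∧ push (c y) n ((c x, m) :: s) = (c y, m * n) :: s) ∨
    (c x ≠ c y ∧ push (c y) n ((c x, m) :: s) = (c y, n) :: (c x, m) :: s) := by
  rcases h with h | ⟨h, h'⟩
  · left; rw [h]; exact ⟨rfl, push_of_eq⟩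
  · right; exact ⟨fun e => h e.le, push_of_incomp h h'⟩

theorem exists_run_eq {u : List B} {x : B} (h : List.IsChain (Adj c) (u ++ [x])) :
    ∃ m s, run c π [] (u ++ [x]) = (c x, m) :: s := by
  induction u using List.reverseRecOn generalizing x with
  | nil => exact ⟨π x, [], rfl⟩
  | append_singleton u y ih =>
    have h' : List.IsChain (Adj c) (u ++ y :: x :: []) := by simpa using h
    obtain ⟨m, s, e⟩ := ih (isChain_left h')
    rw [run_concat, e]
    rcases push_of_adj (m := m) (n := π x) (s := s) (adj_of_isChain h') with ⟨_, h⟩ | ⟨_, h⟩ <;>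
      exact ⟨_, _, h⟩

/-- The first letter is stacked on top, and later letters of a chain only update the top entry or
add a new one, so the old stack is never reached. -/
theorem run_cons_of_incomp {S : List (Y × N)} {a : Y} {m : N} {x : B} {w : List B}
    (hS : ¬ a ≤ c x ∧ ¬ c x ≤ a) (h : List.IsChain (Adj c) (x :: w)) :
    run c π ((a, m) :: S) (x :: w) = run c π [] (x :: w) ++ (a, m) :: S := by
  induction w using List.reverseRecOn with
  | nil => simp [push_of_incomp hS.1 hS.2]
  | append_singleton w y ih =>
    rw [← List.cons_append] at h ⊢
    rw [run_concat, run_concat, ih (List.isChain_append.1 h).1]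
    obtain ⟨w', z, e⟩ : ∃ w' z, x :: w = w' ++ [z] :=
      ⟨_, _, (List.dropLast_append_getLast (List.cons_ne_nil x w)).symm⟩
    rw [e] at h ⊢
    have h' : List.IsChain (Adj c) (w' ++ z :: y :: []) := by simpa using h
    obtain ⟨m', s, e'⟩ := exists_run_eq π (isChain_left h')
    rw [e', List.cons_append]
    have := adj_of_isChain h'
    rcases this with h1 | ⟨h1, h2⟩
    · rw [h1, push_of_eq, push_of_eq, List.cons_append]
    · rw [push_of_incomp h1 h2, push_of_incomp h1 h2]; simp

theorem run_append_of_ne {u w : List B} {a x : B}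
    (h : List.IsChain (Adj c) (u ++ a :: x :: w)) (hne : c a ≠ c x) :
    run c π [] (u ++ a :: x :: w) = run c π [] (x :: w) ++ run c π [] (u ++ [a]) := by
  have e : u ++ a :: x :: w = (u ++ [a]) ++ x :: w := by simp
  obtain ⟨m, s, e'⟩ := exists_run_eq π (isChain_left h)
  rw [e, run_append, e']
  refine run_cons_of_incomp π ((adj_of_isChain h).incomp hne) ?_
  rw [e] at h
  exact isChain_right h

end Stack

/-! ### Reduction to almost normal form and cancellation. -/

section Cancel

variable {B Y : Type*} [PartialOrder Y] (c : B → Y)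

/-- The stack of levels of a word. -/
noncomputable abbrev levels (w : List B) : List (Y × Unit) := run c (fun _ => ()) [] w

variable {c}

theorem push_unit_of_le {a d : Y} {s : List (Y × Unit)} (h : a ≤ d) :
    push d () ((a, ()) :: s) = (a, ()) :: s := by
  rcases h.lt_or_eq with h | rfl
  · exact push_of_gt h
  · exact push_of_eq

theorem incomp_of_not_le {x y : B} {d : Y} (hxy : Adj c x y) (h : d ≤ c x) (h' : ¬ d ≤ c y) :
    ¬ d ≤ c y ∧ ¬ c y ≤ d := by
  refine ⟨h', fun h1 => h' ?_⟩
  rw [hxy.symm.eq_of_le (h1.trans h)]; exact h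

/-- While the top level is at most that of the last letter read, the next letter of a chain leaves
the stack alone or is stacked on it. Nothing is popped, so the initial stack can be recovered. -/
theorem run_unit_injective {w : List B} {x : B} {a a' : Y} {s s' : List (Y × Unit)}
    (hw : List.IsChain (Adj c) (x :: w)) (ha : a ≤ c x) (ha' : a' ≤ c x)
    (h : run c (fun _ => ()) ((a, ()) :: s) w = run c (fun _ => ()) ((a', ()) :: s') w) :
    (a, ()) :: s = (a', ()) :: s' := by
  induction w generalizing x a a' s s' with
  | nil => exact h
  | cons y w ih =>
    have hxy := (List.isChain_cons_cons.1 hw).1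
    have hw' := (List.isChain_cons_cons.1 hw).2
    rw [run_cons, run_cons] at h
    -- One stack absorbs `y`, the other stacks it. Then `d = c y ≤ c x`, so `c y = c x` by
    -- adjacency, and `d'` lies below `c y` after all.
    have mixed : ∀ {d d' : Y} {t t' : List (Y × Unit)}, d ≤ c x → d ≤ c y → d' ≤ c x →
        ¬ d' ≤ c y → (d, ()) :: t = (c y, ()) :: t' → False := by
      intro d d' t t' h1 h2 h3 h4 e
      simp only [List.cons.injEq, Prod.mk.injEq, and_true] at e
      obtain ⟨rfl, -⟩ := e
      exact h4 ((hxy.symm.eq_of_le h1) ▸ h3)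
    by_cases h1 : a ≤ c y <;> by_cases h2 : a' ≤ c y
    · rw [push_unit_of_le h1, push_unit_of_le h2] at h
      exact ih hw' h1 h2 h
    · have := incomp_of_not_le hxy ha' h2
      rw [push_unit_of_le h1, push_of_incomp this.1 this.2] at h
      exact (mixed ha h1 ha' h2 (ih hw' h1 le_rfl h)).elim
    · have := incomp_of_not_le hxy ha h1
      rw [push_unit_of_le h2, push_of_incomp this.1 this.2] at h
      exact (mixed ha' h2 ha h1 (ih hw' le_rfl h2 h).symm).elim
    · have i1 := incomp_of_not_le hxy ha h1
      have i2 := incomp_of_not_le hxy ha' h2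
      rw [push_of_incomp i2.1 i2.2, push_of_incomp i1.1 i1.2] at h
      exact (List.cons.inj (ih hw' le_rfl le_rfl h)).2

variable {M : Type*} [Monoid M]

/-- The product of the images of the letters of a word. -/
def wprod (b : B → M) (w : List B) : M := (w.map b).prod

@[simp] theorem wprod_nil (b : B → M) : wprod b [] = 1 := rfl

@[simp] theorem wprod_cons (b : B → M) (x : B) (w : List B) :
    wprod b (x :: w) = b x * wprod b w := by simp [wprod]

@[simp] theorem wprod_append (b : B → M) (u v : List B) :
    wprod b (u ++ v) = wprod b u * wprod b v := by simp [wprod]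

variable (c) in
/-- A family of idempotents `b x` of levels `c x` in a monoid, with enough relations to reduce
words to almost normal form from the right and to split equal almost normal forms. Here `T` says
that higher letters are absorbed without a trace. -/
structure Reducible (b : B → M) (T : Prop) : Prop where
  idem : ∀ x, b x * b x = b x
  absorb : ∀ a x, c a ≤ c x → ∃ z, c z = c a ∧ b a * b x = b a * b z
  lower : ∀ a x, c x ≤ c a → ∃ z, c z = c x ∧ b a * b x = b z * b x
  inv : ∀ y z, c y = c z → ∃ t, b y * b z * b t = b y
  levels_eq : ∀ u v, wprod b u = wprod b v → levels c u = levels c v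
  strong : T → ∀ a x, c a < c x → b a * b x = b a
  uniform : ¬ T → ∀ a a' x, c a = c a' → c a ≤ c x →
    ∃ z, c z = c a ∧ b a * b x = b a * b z ∧ b a' * b x = b a' * b z
  split : ∀ u a v a' x w, List.IsChain (Adj c) (u ++ a :: x :: w) →
    List.IsChain (Adj c) (v ++ a' :: x :: w) → c a ≠ c x → c a' ≠ c x →
    wprod b (u ++ a :: x :: w) = wprod b (v ++ a' :: x :: w) →
    levels c (u ++ [a]) = levels c (v ++ [a']) → (T ∨ a = a') →
    wprod b (u ++ [a]) = wprod b (v ++ [a'])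

namespace Reducible

variable {b : B → M} {T : Prop}

/-- If `x` is strictly below the last letter `a`, then `lower` trades `a` for a letter `z` at the
level of `x`. The shorter word times `z` is normalised by induction, and `x` is then absorbed at its
end. -/
theorem exists_concat (H : Reducible c b T) (n : ℕ) (u : List B) (hn : u.length ≤ n)
    (hu : List.IsChain (Adj c) u) (x : B) :
    ∃ v a, List.IsChain (Adj c) (v ++ [a]) ∧ c a ≤ c x ∧
      wprod b (v ++ [a]) = wprod b u * b x := by
  induction n generalizing u x with
  | zero =>
    obtain rfl : u = [] := by simpa using hn
    exact ⟨[], x, by simp, le_rfl, by simp⟩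
  | succ n ih =>
    rcases List.eq_nil_or_concat' u with rfl | ⟨u, a, rfl⟩
    · exact ⟨[], x, by simp, le_rfl, by simp⟩
    have below : ∀ {v : List B} {d : B}, List.IsChain (Adj c) (v ++ [d]) → c d ≤ c x →
        wprod b (v ++ [d]) * b x = wprod b (u ++ [a]) * b x →
        ∃ v a', List.IsChain (Adj c) (v ++ [a']) ∧ c a' ≤ c x ∧
          wprod b (v ++ [a']) = wprod b (u ++ [a]) * b x := by
      intro v d hv hd e
      obtain ⟨z, hz, hz'⟩ := H.absorb d x hd
      refine ⟨v ++ [d], z, isChain_concat_concat hv (Or.inl hz.symm), hz ▸ hd, ?_⟩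
      rw [← e]
      simp [mul_assoc, hz']
    rcases order_cases (c a) (c x) with h | h | h | h
    · obtain ⟨z, hz, hz'⟩ := H.lower a x h.le
      obtain ⟨v, d, hv, hd, e⟩ := ih u (by simpa using hn) (List.isChain_append.1 hu).1 z
      refine below hv (hd.trans hz.le) ?_
      rw [e]
      simp [mul_assoc, hz']
    · exact below hu h.le rfl
    · exact below hu h.le rfl
    · exact ⟨u ++ [a], x, isChain_concat_concat hu (Or.inr h), le_rfl, by simp [mul_assoc]⟩

theorem exists_isChain (H : Reducible c b T) (w : List B) :
    ∃ u, List.IsChain (Adj c) u ∧ wprod b u = wprod b w ∧ (w ≠ [] → u ≠ []) := by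
  induction w using List.reverseRecOn with
  | nil => exact ⟨[], by simp, rfl, by simp⟩
  | append_singleton w x ih =>
    obtain ⟨u, hu, e, -⟩ := ih
    obtain ⟨v, a, hv, -, e'⟩ := H.exists_concat _ u le_rfl hu x
    exact ⟨v ++ [a], hv, by simp [e', e], by simp⟩

/-- The two prefixes have the same levels and end below `x`. Each letter of the common suffix is
absorbed by both prefixes until one is incomparable with their last level; there `split` applies. -/
theorem cancel (H : Reducible c b T) {w : List B} {x : B} {u v : List B} {a a' : B}
    (hw : List.IsChain (Adj c) (x :: w)) (hu : List.IsChain (Adj c) (u ++ [a]))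
    (hv : List.IsChain (Adj c) (v ++ [a'])) (hlev : levels c (u ++ [a]) = levels c (v ++ [a']))
    (haa : c a = c a') (ha : c a ≤ c x)
    (h : wprod b (u ++ [a]) * wprod b (x :: w) = wprod b (v ++ [a']) * wprod b (x :: w)) :
    wprod b (u ++ [a]) * b x = wprod b (v ++ [a']) * b x := by
  induction w generalizing x u v a a' with
  | nil => simpa using h
  | cons y w ih =>
    have hxy := (List.isChain_cons_cons.1 hw).1
    have hw' := (List.isChain_cons_cons.1 hw).2
    -- Either `x` vanishes on both sides, or one and the same letter `z` replaces it on both sides;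
    -- at equal levels `z = x` serves.
    have key : (T ∧ c a < c x) ∨ ∃ z, c z = c a ∧ b a * b x = b a * b z ∧
        b a' * b x = b a' * b z := by
      by_cases hT : T
      · rcases ha.lt_or_eq with h1 | h1
        · exact Or.inl ⟨hT, h1⟩
        · exact Or.inr ⟨x, h1.symm, rfl, rfl⟩
      · exact Or.inr (H.uniform hT a a' x haa ha)
    rcases key with ⟨hT, hlt⟩ | ⟨z, hz, e, e'⟩
    · have drop : ∀ {v : List B} {d y : B}, c d < c y →
          wprod b (v ++ [d]) * b y = wprod b (v ++ [d]) := by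
        intro v d y hd
        simp [mul_assoc, H.strong hT d y hd]
      have hlt' := haa ▸ hlt
      rw [wprod_cons, ← mul_assoc, ← mul_assoc, drop hlt, drop hlt'] at h
      rw [drop hlt, drop hlt']
      by_cases hy : c a ≤ c y
      -- Equality would give `c y ≤ c x`, hence `c y = c x` by adjacency, against `c a < c x`.
      · have hay : c a < c y := by
          refine lt_of_le_of_ne hy fun e => ?_
          have := hxy.symm.eq_of_le (e ▸ ha)
          rw [← this, ← e] at hlt
          exact hlt.false
        have := ih hw' hu hv hlev haa hy h
        rwa [drop hay, drop (haa ▸ hay)] at this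
      · have hi := incomp_of_not_le hxy ha hy
        refine H.split u a v a' y w (isChain_glue hu hw' (Or.inr hi))
          (isChain_glue hv hw' (Or.inr (haa ▸ hi))) (fun e => hy e.le)
          (fun e => hy (haa.trans e).le) ?_ hlev (Or.inl hT)
        simpa [mul_assoc] using h
    · have ez : ∀ {v : List B} {d : B}, b d * b x = b d * b z →
          wprod b (v ++ [d]) * b x = wprod b (v ++ [d] ++ [z]) := by
        intro v d h
        simp [mul_assoc, h]
      rw [wprod_cons, ← mul_assoc, ← mul_assoc, ez e, ez e'] at h
      rw [ez e, ez e']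
      have hu' := isChain_concat_concat hu (Or.inl hz.symm : Adj c a z)
      have hv' := isChain_concat_concat hv (Or.inl (haa.symm.trans hz.symm) : Adj c a' z)
      have lev : ∀ {v : List B} {d : B}, List.IsChain (Adj c) (v ++ [d]) → c z = c d →
          levels c (v ++ [d] ++ [z]) = levels c (v ++ [d]) := by
        intro v d hv hd
        obtain ⟨m, s, e⟩ := exists_run_eq (fun _ => ()) hv
        rw [levels, run_concat, levels, e]
        exact push_unit_of_le hd.ge
      have hlev' : levels c (u ++ [a] ++ [z]) = levels c (v ++ [a'] ++ [z]) := by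
        rw [lev hu hz, lev hv (hz.trans haa), hlev]
      by_cases hy : c a ≤ c y
      · have h1 := ih hw' hu' hv' hlev' rfl (hz.trans_le hy) h
        obtain ⟨z', hz', e1⟩ := H.absorb z y (hz.trans_le hy)
        obtain ⟨t, ht⟩ := H.inv z z' hz'.symm
        -- After `z`, the letter `y` acts as some `z'` of the same component, and `inv` undoes
        -- multiplication by `z'`.
        have back : ∀ v : List B, wprod b (v ++ [z]) * b y * b t = wprod b (v ++ [z]) := by
          intro v
          simp only [wprod_append, wprod_cons, wprod_nil, mul_one, mul_assoc]
          rw [← mul_assoc (b z), e1, ht]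
        rw [← back, h1, back]
      · have hi := incomp_of_not_le hxy ha hy
        rw [← hz] at hi
        refine H.split (u ++ [a]) z (v ++ [a']) z y w (isChain_glue hu' hw' (Or.inr hi))
          (isChain_glue hv' hw' (Or.inr hi)) (fun e => hi.1 e.le) (fun e => hi.1 e.le)
          ?_ hlev' (Or.inr rfl)
        simpa [mul_assoc] using h

theorem mul_right_cancel (H : Reducible c b T) {x : B} {w p q : List B}
    (hw : List.IsChain (Adj c) (x :: w))
    (h : wprod b p * wprod b (x :: w) = wprod b q * wprod b (x :: w)) :
    wprod b p * b x = wprod b q * b x := by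
  -- Since `x` is idempotent, `p` may be replaced by `p x`, whose almost normal form ends at a level
  -- below `x`.
  have norm : ∀ p : List B, ∃ u a, List.IsChain (Adj c) (u ++ [a]) ∧ c a ≤ c x ∧
      wprod b (u ++ [a]) = wprod b p * b x := by
    intro p
    obtain ⟨p', hp, e, -⟩ := H.exists_isChain p
    obtain ⟨u, a, hu, ha, e'⟩ := H.exists_concat _ p' le_rfl hp x
    exact ⟨u, a, hu, ha, by rw [e', e]⟩
  obtain ⟨u, a, hu, ha, eu⟩ := norm p
  obtain ⟨v, a', hv, ha', ev⟩ := norm q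
  have absorb : ∀ {u p : List B}, wprod b u = wprod b p * b x →
      wprod b u * wprod b (x :: w) = wprod b p * wprod b (x :: w) := by
    intro u p e
    rw [e, wprod_cons, mul_assoc, ← mul_assoc (b x), H.idem]
  have h' : wprod b (u ++ [a]) * wprod b (x :: w) = wprod b (v ++ [a']) * wprod b (x :: w) := by
    rw [absorb eu, absorb ev, h]
  have hl := H.levels_eq ((u ++ [a]) ++ x :: w) ((v ++ [a']) ++ x :: w)
    (by rw [wprod_append, h', ← wprod_append])
  obtain ⟨m, s, e⟩ := exists_run_eq (fun _ => ()) hu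
  obtain ⟨m', s', e'⟩ := exists_run_eq (fun _ => ()) hv
  have hlev : levels c (u ++ [a]) = levels c (v ++ [a']) := by
    rw [levels, levels, run_append _ _ _ (u ++ [a]), run_append _ _ _ (v ++ [a']), e, e', run_cons, run_cons,
      push_unit_of_le ha, push_unit_of_le ha'] at hl
    rw [levels, levels, e, e']
    exact run_unit_injective hw ha ha' hl
  have haa : c a = c a' := by
    rw [levels, levels, e, e'] at hlev
    exact congrArg Prod.fst (List.cons.inj hlev).1
  have fin : ∀ {u p : List B}, wprod b u = wprod b p * b x → wprod b u * b x = wprod b p * b x := by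
    intro u p e
    rw [e, mul_assoc, H.idem]
  rw [← fin eu, ← fin ev]
  exact H.cancel hw hu hv hlev haa ha h'

end Reducible

end Cancel

/-! ### Components and basic pairs in a band. -/

section Band

variable {B : Type*} [Band B]

theorem comp_mul_of_le {e f : B} (h : comp e ≤ comp f) :
    comp (e * f) = comp e ∧ comp (f * e) = comp e := by
  rw [comp_mul, comp_mul]
  exact ⟨Set.inter_eq_left.2 h, Set.inter_eq_right.2 h⟩

theorem mul_mul_of_comp_eq {e f : B} (h : comp e = comp f) : e * f * e = e :=
  ((comp_eq_iff e f).1 h).1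

/-- The pair `{e, f}` is basic. -/
def IsBasic (e f : B) : Prop := (({e, f} : Set B) ∩ {e * f, f * e}).Nonempty

theorem isBasic_iff {e f : B} :
    IsBasic e f ↔ e * f = e ∨ e * f = f ∨ f * e = e ∨ f * e = f := by
  constructor
  · rintro ⟨x, hx, hx'⟩
    simp only [Set.mem_insert_iff, Set.mem_singleton_iff] at hx hx'
    rcases hx with rfl | rfl <;> rcases hx' with h | h <;> simp [← h]
  · rintro (h | h | h | h)
    · exact ⟨e, by simp, by simp [h]⟩
    · exact ⟨f, by simp, by simp [h]⟩
    · exact ⟨e, by simp, by simp [h]⟩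
    · exact ⟨f, by simp, by simp [h]⟩

theorem IsBasic.symm {e f : B} (h : IsBasic e f) : IsBasic f e := by
  rw [isBasic_iff] at h ⊢
  tauto

theorem IsBasic.comp_le {e f : B} (h : IsBasic e f) : comp e ≤ comp f ∨ comp f ≤ comp e := by
  have h1 : comp (e * f) ≤ comp f := by rw [comp_mul]; exact Set.inter_subset_right
  have h2 : comp (e * f) ≤ comp e := by rw [comp_mul]; exact Set.inter_subset_left
  have h3 : comp (f * e) ≤ comp f := by rw [comp_mul]; exact Set.inter_subset_left
  have h4 : comp (f * e) ≤ comp e := by rw [comp_mul]; exact Set.inter_subset_right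
  rcases isBasic_iff.1 h with h | h | h | h
  · exact Or.inl (h ▸ h1)
  · exact Or.inr (by rwa [h] at h2)
  · exact Or.inl (by rwa [h] at h3)
  · exact Or.inr (by rwa [h] at h4)

/-- Reading a basic pair is the same as reading its product. -/
theorem push_push_of_isBasic {N : Type*} [Semigroup N] (π : B → N)
    (h1 : ∀ e f, IsBasic e f → comp e = comp f → π e * π f = π (e * f))
    (h2 : ∀ e f, comp e < comp f → π (e * f) = π e ∧ π (f * e) = π e)
    {e f : B} (h : IsBasic e f) (s : List (Set B × N)) :
    push (comp f) (π f) (push (comp e) (π e) s) = push (comp (e * f)) (π (e * f)) s := by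
  rcases h.comp_le with hle | hle
  · rcases hle.lt_or_eq with hlt | heq
    · rw [push_push_of_lt hlt, (comp_mul_of_le hle).1, (h2 e f hlt).1]
    · rw [← heq, push_push_same, (comp_mul_of_le hle).1, h1 e f h heq]
  · rcases hle.lt_or_eq with hlt | heq
    · rw [push_push_of_gt hlt, (comp_mul_of_le hle).2, (h2 f e hlt).2]
    · rw [heq, push_push_same, (comp_mul_of_le hle).2, heq, h1 e f h heq.symm]

end Band

/-! ### Invariants of `IG(B)` and relations between generators. -/

section Lift

variable {B : Type*} [Band B]

theorem IG.mk_mul (u v : FreeSemigroup B) : IG.mk (u * v) = IG.mk u * IG.mk v := rfl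

theorem IG.bar_mul {e f : B} (h : IsBasic e f) : IG.bar e * IG.bar f = IG.bar (e * f) := by
  change ((FreeSemigroup.of e * FreeSemigroup.of f : FreeSemigroup B) :
    (conGen (BasicRel B)).Quotient) = _
  exact (Con.eq _).2 (ConGen.Rel.of _ _ (.basic e f h))

theorem IG.lift_eq_of_mk_eq {N : Type*} [Semigroup N] (f : B → N)
    (hf : ∀ x y, IsBasic x y → f x * f y = f (x * y)) {u v : FreeSemigroup B}
    (h : IG.mk u = IG.mk v) : FreeSemigroup.lift f u = FreeSemigroup.lift f v := by
  have h' : conGen (BasicRel B) u v := (Con.eq _).1 h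
  have : conGen (BasicRel B) ≤ Con.ker (FreeSemigroup.lift f) := by
    rw [Con.conGen_le]
    rintro _ _ ⟨x, y, hxy⟩
    simpa [Con.ker_apply] using hf x y hxy
  exact this h'

/-- The generator `x̄` in the monoid `IG(B)¹`. -/
def gen (x : B) : WithOne (IG B) := (IG.bar x : WithOne (IG B))

theorem coe_mk (w : FreeSemigroup B) :
    (IG.mk w : WithOne (IG B)) = wprod gen (w.head :: w.tail) := by
  induction w using FreeSemigroup.recOnMul with
  | ih1 x => simp [gen, IG.bar, FreeSemigroup.of]
  | ih2 x y _ ih =>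
    rw [IG.mk_mul, WithOne.coe_mul, ih]
    rfl

theorem exists_wprod_eq (p : WithOne (IG B)) : ∃ w, wprod gen w = p := by
  rcases eq_or_ne p 1 with rfl | hp
  · exact ⟨[], rfl⟩
  · obtain ⟨a, rfl⟩ := WithOne.ne_one_iff_exists.1 hp
    obtain ⟨w, rfl⟩ : ∃ w, IG.mk w = a := Quotient.exists_rep a
    exact ⟨_, (coe_mk w).symm⟩

/-- The universal property of `IG(B)`, extended to `IG(B)¹`: the adjoined identity is represented by
the empty word only. -/
theorem wprod_eq_of_gen_eq {N : Type*} [Monoid N] (f : B → N)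
    (hf : ∀ x y, IsBasic x y → f x * f y = f (x * y)) {u v : List B}
    (h : wprod gen u = wprod gen v) : wprod f u = wprod f v := by
  have key : ∀ x (w : List B), FreeSemigroup.lift f ⟨x, w⟩ = wprod f (x :: w) := by
    intro x w
    induction w generalizing x with
    | nil => simp [FreeSemigroup.lift]
    | cons y w ih =>
      rw [wprod_cons, ← ih, ← FreeSemigroup.lift_of_mul]; rfl
  have ne : ∀ x (w : List B), wprod gen (x :: w) ≠ 1 := by
    intro x w h
    rw [← coe_mk ⟨x, w⟩] at h
    exact WithOne.coe_ne_one h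
  match u, v with
  | [], [] => rfl
  | [], x :: w => exact (ne x w h.symm).elim
  | x :: w, [] => exact (ne x w h).elim
  | x :: w, y :: z =>
    rw [← coe_mk ⟨x, w⟩, ← coe_mk ⟨y, z⟩, WithOne.coe_inj] at h
    rw [← key, ← key, IG.lift_eq_of_mk_eq f hf h]

theorem run_eq_of_gen_eq {N : Type*} [Semigroup N] (π : B → N)
    (h1 : ∀ e f, IsBasic e f → comp e = comp f → π e * π f = π (e * f))
    (h2 : ∀ e f, comp e < comp f → π (e * f) = π e ∧ π (f * e) = π e)
    {u v : List B} (h : wprod gen u = wprod gen v) : run comp π [] u = run comp π [] v := by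
  -- Reading from left to right is a right action on stacks, hence the opposite of the endomorphism
  -- monoid.
  let f : B → (Function.End (List (Set B × N)))ᵐᵒᵖ := fun x => .op (push (comp x) (π x))
  have hf : ∀ x y, IsBasic x y → f x * f y = f (x * y) := fun x y hxy =>
    MulOpposite.unop_injective (funext fun s => push_push_of_isBasic π h1 h2 hxy s)
  have key : ∀ (w : List B) s, (wprod f w).unop s = run comp π s w := by
    intro w
    induction w with
    | nil => intro s; rfl
    | cons x w ih => intro s; rw [wprod_cons, run_cons, ← ih]; rfl
  rw [← key, ← key, wprod_eq_of_gen_eq f hf h]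

theorem levels_eq_of_gen_eq {u v : List B} (h : wprod gen u = wprod gen v) :
    levels comp u = levels comp v :=
  run_eq_of_gen_eq _ (fun _ _ _ _ => rfl) (fun _ _ _ => ⟨rfl, rfl⟩) h

theorem levels_reverse_eq_of_gen_eq {u v : List B} (h : wprod gen u = wprod gen v) :
    levels comp u.reverse = levels comp v.reverse := by
  let f : B → Function.End (List (Set B × Unit)) := fun x => push (comp x) ()
  have hf : ∀ x y, IsBasic x y → f x * f y = f (x * y) := by
    intro x y hxy
    funext s
    have := push_push_of_isBasic (fun _ => ()) (fun _ _ _ _ => rfl) (fun _ _ _ => ⟨rfl, rfl⟩)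
      hxy.symm s
    have e : comp (y * x) = comp (x * y) := by rw [comp_mul, comp_mul, Set.inter_comm]
    rw [e] at this
    exact this
  have key : ∀ (w : List B), (wprod f w) [] = levels comp w.reverse := by
    intro w
    induction w with
    | nil => rfl
    | cons x w ih => rw [List.reverse_cons, levels, run_concat, ← levels, ← ih]; simp; rfl
  rw [← key, ← key, wprod_eq_of_gen_eq f hf h]

theorem gen_mul {e f : B} (h : e * f = e ∨ e * f = f ∨ f * e = e ∨ f * e = f) :
    gen e * gen f = gen (e * f) := by
  rw [gen, gen, ← WithOne.coe_mul, IG.bar_mul (isBasic_iff.2 h), gen]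

theorem gen_mul_self (x : B) : gen x * gen x = gen x := by
  rw [gen_mul (Or.inl (Band.mul_self x)), Band.mul_self]

theorem mul_mul_of_comp_le {a x : B} (h : comp a ≤ comp x) : a * x * a = a := by
  have h1 := mul_mul_of_comp_eq (comp_mul_of_le h).1.symm
  rwa [← mul_assoc, Band.mul_self] at h1

theorem comp_sandwich {a x : B} (h : comp a ≤ comp x) : comp (x * a * x) = comp a := by
  rw [comp_mul, (comp_mul_of_le h).2]; exact Set.inter_eq_left.2 h

/-- Insert `xa` between the factors: `(a, xa)` is basic with product `a`, and `(xa, x)` is basic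
with product `xax`. The next lemma is dual. -/
theorem gen_mul_of_le {a x : B} (h : comp a ≤ comp x) :
    gen a * gen x = gen a * gen (x * a * x) := by
  have e1 : a * (x * a) = a := by rw [← mul_assoc, mul_mul_of_comp_le h]
  have e2 : gen a = gen a * gen (x * a) := by rw [gen_mul (Or.inl e1), e1]
  have e3 : x * (x * a) = x * a := by rw [← mul_assoc, Band.mul_self]
  have e4 : gen (x * a) * gen x = gen (x * a * x) := by
    rw [gen_mul (Or.inr (Or.inr (Or.inl e3)))]
  rw [← e4, ← mul_assoc, ← e2]

theorem gen_mul_of_ge {a x : B} (h : comp x ≤ comp a) :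
    gen a * gen x = gen (a * x * a) * gen x := by
  have e1 : x * a * x = x := mul_mul_of_comp_le h
  have e2 : gen x = gen (x * a) * gen x := by rw [gen_mul (Or.inr (Or.inl e1)), e1]
  have e3 : x * a * a = x * a := by rw [mul_assoc, Band.mul_self]
  have e4 : gen a * gen (x * a) = gen (a * x * a) := by
    rw [gen_mul (Or.inr (Or.inr (Or.inr e3))), mul_assoc]
  rw [← e4, mul_assoc, ← e2]

/-- A product of two letters of the same component is `𝓡`-related to its first letter. -/
theorem gen_mul_gen_mul {y z : B} (h : comp y = comp z) :
    gen y * gen z * gen (z * y) = gen y := by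
  have e1 : z * (z * y) = z * y := by rw [← mul_assoc, Band.mul_self]
  have e2 : y * (z * y) = y := by rw [← mul_assoc, mul_mul_of_comp_eq h]
  rw [mul_assoc, gen_mul (Or.inr (Or.inl e1)), e1, gen_mul (Or.inl e2), e2]

end Lift

/-! ### Uniqueness of blocks over a locally large band. -/

section LocallyLarge

variable {B : Type*} [Band B]

theorem IsLocallyLarge.gen_mul_gen (hB : IsLocallyLarge B) {u v : B} (h : comp u < comp v) :
    gen u * gen v = gen u ∧ gen v * gen u = gen u := by
  obtain ⟨h1, h2⟩ := hB u v h
  exact ⟨by rw [gen_mul (Or.inl h1), h1], by rw [gen_mul (Or.inr (Or.inl h2)), h2]⟩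

/-- The product of the weights of a stack, from bottom to top. -/
def stackProd {Y M : Type*} [Monoid M] : List (Y × M) → M
  | [] => 1
  | p :: s => stackProd s * p.2

/-- On an almost normal form no letter is discarded, so equal stacks force equal products. -/
theorem stackProd_run {B Y M : Type*} [PartialOrder Y] [Monoid M] {c : B → Y} (b : B → M)
    {w : List B} (h : List.IsChain (Adj c) w) : stackProd (run c b [] w) = wprod b w := by
  induction w using List.reverseRecOn with
  | nil => rfl
  | append_singleton w x ih =>
    have ih := ih (List.isChain_append.1 h).1
    rw [run_concat, wprod_append, ← ih]
    rcases List.eq_nil_or_concat' w with rfl | ⟨w, y, rfl⟩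
    · simp [stackProd]
    · have h' : List.IsChain (Adj c) (w ++ y :: x :: []) := by simpa using h
      obtain ⟨m, s, e⟩ := exists_run_eq b (isChain_left h')
      rw [e]
      rcases push_of_adj (m := m) (n := b x) (s := s) (adj_of_isChain h') with ⟨_, h⟩ | ⟨_, h⟩ <;>
        rw [h] <;> simp [stackProd, mul_assoc]

/-- In the free idempotent generated semigroup over a locally large band, almost normal forms are
unique up to equality of the corresponding blocks. -/
theorem IsLocallyLarge.split (hB : IsLocallyLarge B) {u w v z : List B} {a x a' y : B}
    (hu : List.IsChain (Adj comp) (u ++ a :: x :: w))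
    (hv : List.IsChain (Adj comp) (v ++ a' :: y :: z))
    (hax : comp a ≠ comp x) (hay : comp a' ≠ comp y)
    (h : wprod gen (u ++ a :: x :: w) = wprod gen (v ++ a' :: y :: z))
    (hl : (levels comp (u ++ [a])).length = (levels comp (v ++ [a'])).length) :
    wprod gen (u ++ [a]) = wprod gen (v ++ [a']) ∧ wprod gen (x :: w) = wprod gen (y :: z) := by
  have hr : run comp gen [] (u ++ a :: x :: w) = run comp gen [] (v ++ a' :: y :: z) := by
    refine run_eq_of_gen_eq gen (fun e f hef _ => gen_mul (isBasic_iff.1 hef)) ?_ h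
    intro e f hef
    rw [(hB e f hef).1, (hB e f hef).2]
    exact ⟨rfl, rfl⟩
  rw [run_append_of_ne gen hu hax, run_append_of_ne gen hv hay] at hr
  have len : ∀ w : List B, (run comp gen [] w).length = (levels comp w).length := by
    intro w
    have := congrArg List.length (map_fst_run comp gen (fun _ => ()) w)
    simpa using this
  obtain ⟨h1, h2⟩ := List.append_inj' hr (by rw [len, len, hl])
  have hxw : List.IsChain (Adj comp) (x :: w) := (isChain_right hu).tail
  have hyz : List.IsChain (Adj comp) (y :: z) := (isChain_right hv).tail
  rw [← stackProd_run gen (isChain_left hu), ← stackProd_run gen (isChain_left hv), h2,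
    ← stackProd_run gen hxw, ← stackProd_run gen hyz]
  exact ⟨rfl, congrArg stackProd h1⟩

end LocallyLarge

/-! ### The cancellation hypotheses for `IG(B)¹`. -/

section Reducible

variable {B : Type*} [Band B]

variable (B) in
/-- Equal almost normal forms that are cut after the same number of blocks have equal first parts
if the first parts end in the same letter, and equal second parts if these start with the same
letter. -/
def SplitsAtLetters : Prop :=
  ∀ (u w v z : List B) (a x a' y : B), List.IsChain (Adj comp) (u ++ a :: x :: w) →
    List.IsChain (Adj comp) (v ++ a' :: y :: z) → comp a ≠ comp x → comp a' ≠ comp y →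
    wprod gen (u ++ a :: x :: w) = wprod gen (v ++ a' :: y :: z) →
    (levels comp (u ++ [a])).length = (levels comp (v ++ [a'])).length →
    (a = a' → wprod gen (u ++ [a]) = wprod gen (v ++ [a'])) ∧
      (x = y → wprod gen (x :: w) = wprod gen (y :: z))

/-- This makes the letter absorbed in place of `x` depend only on the component of the letter before
it, so it is common to both sides of an equation. -/
theorem IsNormalBand.sandwich_eq (hB : IsNormalBand B) {a a' x : B} (h : comp a = comp a') :
    x * a * x = x * a' * x := by
  have e1 : a * (a' * a) = a := by rw [← mul_assoc, mul_mul_of_comp_eq h]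
  have e2 : a' * (a * a') = a' := by rw [← mul_assoc, mul_mul_of_comp_eq h.symm]
  calc x * a * x = x * a * (a' * a) * x := by rw [mul_assoc x a (a' * a), e1]
    _ = x * (a' * a) * a * x := hB _ _ _
    _ = x * a' * a * x := by simp only [mul_assoc]; rw [← mul_assoc a a, Band.mul_self]
    _ = x * a * a' * x := hB _ _ _
    _ = x * (a * a') * a' * x := by
      simp only [mul_assoc]; rw [← mul_assoc a' a', Band.mul_self]
    _ = x * a' * (a * a') * x := hB _ _ _
    _ = x * a' * x := by rw [mul_assoc x a' (a * a'), e2]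

theorem uniform_sandwich (hB : IsNormalBand B ∨ IsLocallyLarge B) (hT : ¬ IsLocallyLarge B)
    (a a' x : B) (h : comp a = comp a') (hx : comp a ≤ comp x) :
    comp (x * a * x) = comp a ∧ gen a * gen x = gen a * gen (x * a * x) ∧
      gen a' * gen x = gen a' * gen (x * a * x) := by
  refine ⟨comp_sandwich hx, gen_mul_of_le hx, ?_⟩
  rw [(hB.resolve_right hT).sandwich_eq h]
  exact gen_mul_of_le (h ▸ hx)

theorem reducible_gen (hB : IsNormalBand B ∨ IsLocallyLarge B) (hS : SplitsAtLetters B) :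
    Reducible (comp (B := B)) gen (IsLocallyLarge B) where
  idem := gen_mul_self
  absorb a x h := ⟨_, comp_sandwich h, gen_mul_of_le h⟩
  lower a x h := ⟨_, comp_sandwich h, gen_mul_of_ge h⟩
  inv y z h := ⟨_, gen_mul_gen_mul h⟩
  levels_eq u v h := levels_eq_of_gen_eq h
  strong hT a x h := (hT.gen_mul_gen h).1
  uniform hT a a' x h hx := ⟨_, uniform_sandwich hB hT a a' x h hx⟩
  split u a v a' x w hu hv hax hax' h hl hT := by
    rcases hT with hT | rfl
    · exact (hT.split hu hv hax hax' h (by rw [hl])).1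
    · exact (hS u w v w a x a x hu hv hax hax' h (by rw [hl])).1 rfl

end Reducible

/-! ### The cancellation hypotheses for the opposite monoid. -/

section Op

variable {B : Type*} [Band B]

/-- The generator `x̄` in the opposite of the monoid `IG(B)¹`. -/
def genOp (x : B) : (WithOne (IG B))ᵐᵒᵖ := .op (gen x)

theorem wprod_genOp (w : List B) : wprod genOp w = .op (wprod gen w.reverse) := by
  induction w with
  | nil => rfl
  | cons x w ih => simp [ih, genOp]

theorem isChain_reverse {w : List B} (h : List.IsChain (Adj comp) w) :
    List.IsChain (Adj comp) w.reverse := by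
  rw [List.isChain_reverse]
  exact h.imp fun _ _ => Adj.symm

theorem genOp_mul_eq {a b x y : B} (h : gen b * gen a = gen y * gen x) :
    genOp a * genOp b = genOp x * genOp y := by
  rw [genOp, genOp, genOp, genOp, ← MulOpposite.op_mul, h, MulOpposite.op_mul]

theorem reducible_genOp (hB : IsNormalBand B ∨ IsLocallyLarge B) (hS : SplitsAtLetters B) :
    Reducible (comp (B := B)) genOp (IsLocallyLarge B) where
  idem x := by rw [genOp, ← MulOpposite.op_mul, gen_mul_self]
  absorb a x h := ⟨_, comp_sandwich h, genOp_mul_eq (gen_mul_of_ge h)⟩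
  lower a x h := ⟨_, comp_sandwich h, genOp_mul_eq (gen_mul_of_le h)⟩
  inv y z h := by
    refine ⟨y * z, MulOpposite.unop_injective ?_⟩
    have e1 : y * z * z = y * z := by rw [mul_assoc, Band.mul_self]
    have e2 : y * z * y = y := mul_mul_of_comp_eq h
    change gen (y * z) * (gen z * gen y) = gen y
    rw [← mul_assoc, gen_mul (Or.inl e1), e1, gen_mul (Or.inr (Or.inl e2)), e2]
  levels_eq u v h := by
    rw [wprod_genOp, wprod_genOp] at h
    simpa using levels_reverse_eq_of_gen_eq (MulOpposite.op_injective h)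
  strong hT a x h := by
    rw [genOp, genOp, ← MulOpposite.op_mul, (hT.gen_mul_gen h).2]
  uniform hT a a' x h hx := by
    refine ⟨x * a * x, comp_sandwich hx, genOp_mul_eq (gen_mul_of_ge hx), ?_⟩
    rw [(hB.resolve_right hT).sandwich_eq h]
    exact genOp_mul_eq (gen_mul_of_ge (h ▸ hx))
  split u a v a' x w hu hv hax hax' h hl hT := by
    rw [wprod_genOp, wprod_genOp] at h ⊢
    have h := MulOpposite.op_injective h
    have hu := isChain_reverse hu
    have hv := isChain_reverse hv
    simp only [List.reverse_append, List.reverse_cons, List.append_assoc,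
      List.cons_append, List.nil_append, List.reverse_nil] at h hu hv ⊢
    congr 1
    -- After reversal the common suffix is a common prefix, so the cuts match by `rfl` and the
    -- second halves are compared.
    rcases hT with hT | rfl
    · exact (hT.split hu hv hax.symm hax'.symm h rfl).2
    · exact (hS _ _ _ _ _ _ _ _ hu hv hax.symm hax'.symm h rfl).2 rfl

end Op

/-! ### Block ends as significant indices. -/

section Count

/-- `c p` is the number of blocks of equal consecutive levels among `a 1, …, a p`, and different
consecutive levels are incomparable. -/
structure CountsBlocks {Y : Type*} [PartialOrder Y] (a : ℕ → Y) (n : ℕ) (c : ℕ → ℕ) : Prop where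
  pos : 0 < n
  zero : c 0 = 0
  one : c 1 = 1
  step : ∀ p, 1 ≤ p → p < n → (a p = a (p + 1) ∧ c (p + 1) = c p) ∨
    ((¬ a p ≤ a (p + 1) ∧ ¬ a (p + 1) ≤ a p) ∧ c (p + 1) = c p + 1)

/-- The end of the `s`-th block. -/
def blockEnd (n : ℕ) (c : ℕ → ℕ) (s : ℕ) : ℕ := Nat.findGreatest (fun p => c p ≤ s) n

namespace CountsBlocks

variable {Y : Type*} [PartialOrder Y] {a : ℕ → Y} {n : ℕ} {c : ℕ → ℕ} {s : ℕ}

theorem succ_bounds (H : CountsBlocks a n c) {p : ℕ} (hp : p < n) :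
    c p ≤ c (p + 1) ∧ c (p + 1) ≤ c p + 1 := by
  rcases Nat.eq_zero_or_pos p with rfl | h
  · simp [H.zero, H.one]
  · rcases H.step p h hp with ⟨-, h⟩ | ⟨-, h⟩ <;> omega

theorem mono (H : CountsBlocks a n c) {p q : ℕ} (hpq : p ≤ q) (hq : q ≤ n) : c p ≤ c q := by
  induction q, hpq using Nat.le_induction with
  | base => exact le_rfl
  | succ q _ ih => exact (ih (by omega)).trans (H.succ_bounds (by omega)).1

theorem blockEnd_le : blockEnd n c s ≤ n := Nat.findGreatest_le n

theorem count_gt {p : ℕ} (h : blockEnd n c s < p) (hp : p ≤ n) : s < c p :=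
  not_le.1 (Nat.findGreatest_is_greatest (P := fun p => c p ≤ s) h hp)

theorem count_blockEnd (H : CountsBlocks a n c) (hs : s ≤ c n) : c (blockEnd n c s) = s := by
  have h1 : c (blockEnd n c s) ≤ s :=
    Nat.findGreatest_spec (P := fun p => c p ≤ s) (Nat.zero_le n) (by simp [H.zero])
  rcases (blockEnd_le (n := n) (c := c) (s := s)).lt_or_eq with h | h
  · have h2 := count_gt (c := c) (Nat.lt_add_one (blockEnd n c s)) h
    have h3 := (H.succ_bounds h).2
    omega
  · rw [h] at h1 ⊢; omega

theorem blockEnd_lt (H : CountsBlocks a n c) (hs : s < c n) : blockEnd n c s < n := by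
  refine lt_of_le_of_ne blockEnd_le fun h => ?_
  have := H.count_blockEnd hs.le
  rw [h] at this; omega

theorem count_blockEnd_succ (H : CountsBlocks a n c) (hs : s < c n) :
    c (blockEnd n c s + 1) = s + 1 := by
  have h := H.blockEnd_lt hs
  have h2 := count_gt (c := c) (Nat.lt_add_one (blockEnd n c s)) h
  have h3 := (H.succ_bounds h).2
  have := H.count_blockEnd hs.le
  omega

theorem blockEnd_eq (H : CountsBlocks a n c) {p : ℕ} (hp : p < n) (h : c p < c (p + 1)) :
    blockEnd n c (c p) = p := by
  refine Nat.findGreatest_eq_iff.2 ⟨hp.le, fun _ => le_rfl, fun q h1 h2 => ?_⟩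
  exact not_le.2 (h.trans_le (H.mono h1 h2))

theorem blockEnd_zero (H : CountsBlocks a n c) : blockEnd n c 0 = 0 := by
  have := H.blockEnd_eq H.pos (by simp [H.zero, H.one])
  rwa [H.zero] at this

theorem blockEnd_last : blockEnd n c (c n) = n :=
  le_antisymm blockEnd_le (Nat.le_findGreatest le_rfl le_rfl)

theorem blockEnd_lt_blockEnd (H : CountsBlocks a n c) (hs : s < c n) :
    blockEnd n c s < blockEnd n c (s + 1) :=
  Nat.le_findGreatest (H.blockEnd_lt hs) (H.count_blockEnd_succ hs).le

theorem blockEnd_pos (H : CountsBlocks a n c) (hs : s < c n) : 1 ≤ blockEnd n c (s + 1) :=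
  Nat.succ_le_of_lt ((Nat.zero_le _).trans_lt (H.blockEnd_lt_blockEnd hs))

theorem level_eq (H : CountsBlocks a n c) (hs : s < c n) {p : ℕ} (h1 : blockEnd n c s < p)
    (h2 : p ≤ blockEnd n c (s + 1)) : a p = a (blockEnd n c s + 1) := by
  induction p, (show blockEnd n c s + 1 ≤ p from h1) using Nat.le_induction with
  | base => rfl
  | succ p hp ih =>
    have ih := ih hp (by omega)
    have hn := blockEnd_le (n := n) (c := c) (s := s + 1)
    have e1 := H.mono (p := blockEnd n c s + 1) (q := p) hp (by omega)
    have e2 := H.mono h2 hn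
    rw [H.count_blockEnd_succ hs] at e1
    rw [H.count_blockEnd (show s + 1 ≤ c n from hs)] at e2
    rcases H.step p (by omega) (by omega) with ⟨h, -⟩ | ⟨-, h⟩
    · rw [← h, ih]
    · omega

theorem incomp (H : CountsBlocks a n c) (hs : s + 1 ≤ c n) (h : blockEnd n c (s + 1) < n) :
    ¬ a (blockEnd n c (s + 1)) ≤ a (blockEnd n c (s + 1) + 1) ∧
      ¬ a (blockEnd n c (s + 1) + 1) ≤ a (blockEnd n c (s + 1)) := by
  rcases H.step _ (H.blockEnd_pos hs) h with ⟨-, e⟩ | ⟨h, -⟩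
  · have := count_gt (c := c) (Nat.lt_add_one (blockEnd n c (s + 1))) h
    rw [e, H.count_blockEnd hs] at this
    omega
  · exact h

/-- A candidate beyond the block end lies below its predecessor, so the two levels are equal and the
predecessor is a candidate too. Descending reaches the first letter of the next block, which is
incomparable with the block end. -/
theorem isGreatest (H : CountsBlocks a n c) (hs : s < c n) :
    IsGreatest {p | blockEnd n c s < p ∧ p ≤ n ∧ ∀ q, blockEnd n c s < q → q ≤ p → a p ≤ a q}
      (blockEnd n c (s + 1)) := by
  have hlt := H.blockEnd_lt_blockEnd hs
  refine ⟨⟨hlt, blockEnd_le, fun q h1 h2 => ?_⟩, ?_⟩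
  · rw [H.level_eq hs h1 h2, H.level_eq hs hlt le_rfl]
  · rintro p ⟨-, h2, h3⟩
    by_contra! hp
    induction p, (show blockEnd n c (s + 1) + 1 ≤ p from hp) using Nat.le_induction with
    | base => exact (H.incomp hs h2).2 (h3 _ hlt (by omega))
    | succ p hp' ih =>
      have h4 := h3 p (by omega) (by omega)
      rcases H.step p (by omega) (by omega) with ⟨e, -⟩ | ⟨e, -⟩
      · exact ih (by omega) (fun q h5 h6 => e ▸ h3 q h5 (by omega)) hp'
      · exact e.2 h4

theorem isGreatest' (H : CountsBlocks a n c) (hs : s < c n) :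
    IsGreatest {m | blockEnd n c (s + 1) ≤ m ∧ m ≤ n ∧ ∀ q, blockEnd n c (s + 1) ≤ q → q ≤ m →
      a (blockEnd n c (s + 1)) ≤ a q} (blockEnd n c (s + 1)) := by
  refine ⟨⟨le_rfl, blockEnd_le, fun q h1 h2 => by rw [le_antisymm h1 h2]⟩, ?_⟩
  rintro m ⟨-, h2, h3⟩
  by_contra! h
  exact (H.incomp hs (by omega)).1 (h3 _ (by omega) h)

end CountsBlocks

end Count

/-! ### Words as lists of letters, and almost normal forms as chains. -/

section Letters

variable {B : Type*}

/-- The list of letters of a word. -/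
def letters (w : FreeSemigroup B) : List B := w.head :: w.tail

theorem length_letters (w : FreeSemigroup B) : (letters w).length = w.length := rfl

theorem exists_letters_eq {l : List B} (h : l ≠ []) : ∃ w : FreeSemigroup B, letters w = l := by
  obtain ⟨x, t, rfl⟩ := List.exists_cons_of_ne_nil h
  exact ⟨⟨x, t⟩, rfl⟩

theorem letter_succ {w : FreeSemigroup B} {p : ℕ} (h : p < (letters w).length) :
    letter w (p + 1) = (letters w)[p] := by
  simp only [letter, Nat.add_sub_cancel]
  exact List.getD_eq_getElem _ _ h

theorem letter_of_eq_append {w : FreeSemigroup B} {u v : List B} {x : B}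
    (h : letters w = u ++ x :: v) : letter w (u.length + 1) = x := by
  rw [letter_succ (by simp [h])]
  simp [h]

theorem letters_subword {w : FreeSemigroup B} {p q : ℕ} (hpq : p ≤ q) (hq : q < w.length) :
    letters (subword w (p + 1) (q + 1)) = ((letters w).drop p).take (q + 1 - p) := by
  have hlen : (letters (subword w (p + 1) (q + 1))).length = q + 1 - p := by
    simp [letters, subword]; omega
  have hq' : q < (letters w).length := hq
  refine List.ext_getElem (by rw [hlen]; simp; omega) fun k h1 h2 => ?_
  rw [hlen] at h1
  have e : (letters (subword w (p + 1) (q + 1)))[k] = letter w (p + k + 1) := by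
    rcases k with _ | k
    · rfl
    · simp only [letters, subword, List.getElem_cons_succ, List.getElem_map,
        List.getElem_range']
      congr 1; omega
  rw [e, letter_succ (by omega)]
  simp

theorem exists_split {w : FreeSemigroup B} {p : ℕ} (h1 : 1 ≤ p) (h2 : p < w.length) :
    ∃ u v, letters w = u ++ letter w p :: letter w (p + 1) :: v ∧
      (letters w).take p = u ++ [letter w p] ∧ (letters w).drop p = letter w (p + 1) :: v := by
  obtain ⟨p, rfl⟩ : ∃ q, p = q + 1 := ⟨p - 1, by omega⟩
  have h2' : p + 1 < (letters w).length := h2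
  have e1 : (letters w).take (p + 1) = (letters w).take p ++ [letter w (p + 1)] := by
    rw [letter_succ (by omega), List.take_append_getElem]
  have e2 : (letters w).drop (p + 1) = letter w (p + 1 + 1) :: (letters w).drop (p + 1 + 1) := by
    rw [letter_succ h2', List.cons_getElem_drop_succ]
  refine ⟨_, _, ?_, e1, e2⟩
  conv_lhs => rw [← List.take_append_drop (p + 1) (letters w), e1, e2]
  simp

theorem take_length_succ {u w : List B} {a x : B} :
    (u ++ a :: x :: w).take (u.length + 1) = u ++ [a] := by
  rw [List.take_append, List.take_of_length_le (by omega)]; simp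

theorem drop_length_succ {u w : List B} {a x : B} :
    (u ++ a :: x :: w).drop (u.length + 1) = x :: w := by
  rw [List.drop_append, List.drop_of_length_le (by omega)]; simp

variable [Band B]

theorem mk_subword_left {w : FreeSemigroup B} {p : ℕ} (h1 : 1 ≤ p) (h2 : p ≤ w.length) :
    (IG.mk (subword w 1 p) : WithOne (IG B)) = wprod gen ((letters w).take p) := by
  obtain ⟨p, rfl⟩ : ∃ q, p = q + 1 := ⟨p - 1, by omega⟩
  rw [coe_mk]
  exact congrArg _ (letters_subword (p := 0) (Nat.zero_le p) h2)

theorem mk_subword_right {w : FreeSemigroup B} {p : ℕ} (h : p < w.length) :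
    (IG.mk (subword w (p + 1) w.length) : WithOne (IG B)) = wprod gen ((letters w).drop p) := by
  rw [coe_mk]
  have := letters_subword (w := w) (p := p) (q := w.length - 1) (by omega) (by omega)
  rw [Nat.sub_add_cancel (by omega)] at this
  refine congrArg _ (this.trans (List.take_of_length_le ?_))
  rw [List.length_drop, length_letters]

/-- The number of blocks in the first `p` letters. -/
noncomputable def blockCount (w : FreeSemigroup B) (p : ℕ) : ℕ :=
  (levels comp ((letters w).take p)).length

theorem countsBlocks {w : FreeSemigroup B} (h : List.IsChain (Adj comp) (letters w)) :
    CountsBlocks (fun p => comp (letter w p)) w.length (blockCount w) where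
  pos := Nat.succ_pos _
  zero := rfl
  one := by simp [blockCount, levels, letters]
  step p h1 h2 := by
    obtain ⟨u, v, e1, e2, -⟩ := exists_split h1 h2
    rw [e1] at h
    have e3 : (letters w).take (p + 1) = u ++ [letter w p] ++ [letter w (p + 1)] := by
      have h2' : p < (letters w).length := h2
      rw [letter_succ h2', ← e2, List.take_append_getElem]
    obtain ⟨m, s, e⟩ := exists_run_eq (fun _ => ()) (isChain_left h)
    rw [blockCount, blockCount, e3, e2, levels, levels, run_concat, e]
    rcases push_of_adj (m := m) (n := ()) (s := s) (adj_of_isChain h) with ⟨h1, h2⟩ | ⟨h1, h2⟩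
    · exact Or.inl ⟨h1, by rw [h2]; simp⟩
    · exact Or.inr ⟨(adj_of_isChain h).incomp h1, by rw [h2]; simp⟩

theorem isSignificant_blockEnd {w : FreeSemigroup B} (h : List.IsChain (Adj comp) (letters w)) :
    IsSignificant w (blockCount w w.length) (blockEnd w.length (blockCount w)) :=
  have H := countsBlocks h
  ⟨H.blockEnd_zero, _, H.blockEnd_zero, CountsBlocks.blockEnd_last, fun _ hs =>
    ⟨H.isGreatest hs, H.isGreatest' hs⟩⟩

/-- On an almost normal form both `i s` and `k s` are forced to be the end of block `s`, and `k r =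
n` then forces `r` to be the number of blocks. -/
theorem IsSignificant.unique {w : FreeSemigroup B} (h : List.IsChain (Adj comp) (letters w))
    {r : ℕ} {i : ℕ → ℕ} (hi : IsSignificant w r i) :
    r = blockCount w w.length ∧ ∀ s ≤ r, i s = blockEnd w.length (blockCount w) s := by
  have H := countsBlocks h
  obtain ⟨i0, k, k0, kr, hk⟩ := hi
  have key : ∀ s ≤ r, s ≤ blockCount w w.length →
      k s = blockEnd w.length (blockCount w) s ∧ i s = blockEnd w.length (blockCount w) s := by
    intro s
    induction s with
    | zero => intro _ _; rw [H.blockEnd_zero]; exact ⟨k0, i0⟩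
    | succ s ih =>
      intro h1 h2
      have ih := (ih (by omega) (by omega)).1
      obtain ⟨g1, g2⟩ := hk s (by omega)
      rw [ih] at g1
      have e := g1.unique (H.isGreatest h2)
      rw [e] at g2
      exact ⟨g2.unique (H.isGreatest' h2), e⟩
  have hr : r = blockCount w w.length := by
    rcases lt_trichotomy r (blockCount w w.length) with h | h | h
    · have := H.count_blockEnd h.le
      rw [← (key r le_rfl h.le).1, kr] at this
      exact this.symm
    · exact h
    · have h1 := (hk _ h).1.1
      rw [(key _ h.le le_rfl).1, CountsBlocks.blockEnd_last] at h1
      exact absurd h1.1 (not_lt.2 h1.2.1)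
  exact ⟨hr, fun s hs => (key s hs (hs.trans hr.le)).2⟩

theorem isAlmostNormal_iff {w : FreeSemigroup B} :
    IsAlmostNormal w ↔ List.IsChain (Adj comp) (letters w) := by
  constructor
  · rintro ⟨r, i, α, i0, ir, hi, hα, hinc⟩
    rw [List.isChain_iff_getElem]
    intro p hp
    have hp' : p + 1 < w.length := hp
    rw [← letter_succ, ← letter_succ]
    classical
    -- The least such `s` is the end of the block containing position `p + 1`; the list index `p` is
    -- shifted by one.
    have hex : ∃ s, p + 1 ≤ i s := ⟨r, by omega⟩
    have h1 := Nat.find_spec hex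
    have hr : Nat.find hex ≤ r := Nat.find_min' hex (by omega)
    obtain ⟨s, hs⟩ : ∃ s, Nat.find hex = s + 1 := by
      refine ⟨Nat.find hex - 1, (Nat.sub_add_cancel ?_).symm⟩
      rcases Nat.eq_zero_or_pos (Nat.find hex) with h | h
      · rw [h, i0] at h1; omega
      · exact h
    have h2 : i s < p + 1 := not_le.1 (Nat.find_min hex (by omega))
    rw [hs] at h1 hr
    rw [Adj, hα s (by omega) _ h2 h1]
    rcases h1.lt_or_eq with h3 | h3
    · exact Or.inl (hα s (by omega) _ (by omega) (by omega)).symm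
    · have hsr : s + 1 < r := by
        refine lt_of_le_of_ne hr fun h => ?_
        rw [h, ir] at h3; omega
      have := hi (s + 1) hsr
      rw [hα (s + 1) hsr _ (by omega) (by omega)]
      exact Or.inr (hinc s hsr)
  · intro h
    have H := countsBlocks h
    refine ⟨blockCount w w.length, blockEnd w.length (blockCount w),
      fun s => comp (letter w (blockEnd w.length (blockCount w) s + 1)), H.blockEnd_zero,
      CountsBlocks.blockEnd_last, fun s hs => H.blockEnd_lt_blockEnd hs,
      fun s hs p h1 h2 => H.level_eq hs h1 h2, fun s hs => ?_⟩
    have := H.incomp hs.le (H.blockEnd_lt hs)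
    rwa [H.level_eq (by omega) (H.blockEnd_lt_blockEnd (by omega)) le_rfl] at this

end Letters

/-! ### Condition (P), the starred relations and abundance. -/

section Main

variable {B : Type*} [Band B]

theorem blockCount_eq_of_split {W : FreeSemigroup B} {u w : List B} {a x : B}
    (hW : letters W = u ++ a :: x :: w) (h : List.IsChain (Adj comp) (u ++ a :: x :: w))
    (hne : comp a ≠ comp x) :
    blockEnd W.length (blockCount W) (levels comp (u ++ [a])).length = u.length + 1 ∧
      (levels comp (u ++ [a])).length < blockCount W W.length := by
  have H := countsBlocks (hW ▸ h)
  have hlen : W.length = u.length + 2 + w.length := by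
    rw [← length_letters, hW]; simp; omega
  have e1 : blockCount W (u.length + 1) = (levels comp (u ++ [a])).length := by
    rw [blockCount, hW, take_length_succ]
  have hlt : blockCount W (u.length + 1) < blockCount W (u.length + 1 + 1) := by
    rcases H.step (u.length + 1) (by omega) (by omega) with ⟨e, -⟩ | ⟨-, e⟩
    · have e2 : letter W (u.length + 1 + 1) = x := by
        have := letter_of_eq_append (w := W) (u := u ++ [a]) (x := x) (v := w) (by simp [hW])
        simpa using this
      rw [letter_of_eq_append hW, e2] at e
      exact absurd e hne
    · omega
  rw [← e1]
  exact ⟨H.blockEnd_eq (by omega) hlt, hlt.trans_le (H.mono (by omega) le_rfl)⟩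

/-- The cut is a block end, so it is the significant index numbered by the blocks before it. Equal
letters are trivially `𝓛`- and `𝓡`-related. -/
theorem ConditionP.splitsAtLetters (hP : ConditionP B) : SplitsAtLetters B := by
  intro u w v z a x a' y hu hv hax hay h hl
  obtain ⟨U, hU⟩ := exists_letters_eq (l := u ++ a :: x :: w) (by simp)
  obtain ⟨V, hV⟩ := exists_letters_eq (l := v ++ a' :: y :: z) (by simp)
  have hmk : IG.mk U = IG.mk V := by
    rw [← WithOne.coe_inj, coe_mk, coe_mk]
    exact (hU ▸ hV ▸ h : wprod gen (letters U) = wprod gen (letters V))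
  have hU' : List.IsChain (Adj comp) (letters U) := hU ▸ hu
  have hV' : List.IsChain (Adj comp) (letters V) := hV ▸ hv
  have hr : blockCount U U.length = blockCount V V.length := by
    rw [blockCount, blockCount, ← length_letters, ← length_letters, List.take_length,
      List.take_length, hU, hV, levels_eq_of_gen_eq h]
  obtain ⟨eU, ltU⟩ := blockCount_eq_of_split hU hu hax
  obtain ⟨eV, ltV⟩ := blockCount_eq_of_split hV hv hay
  obtain ⟨h1, h2⟩ := hP U V (isAlmostNormal_iff.2 hU') (isAlmostNormal_iff.2 hV') hmk _ _ _
    (isSignificant_blockEnd hU') (hr ▸ isSignificant_blockEnd hV')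
  have hpos : 1 ≤ (levels comp (u ++ [a])).length := by
    obtain ⟨m, s, e⟩ := exists_run_eq (fun _ => ()) (isChain_left hu)
    rw [levels, e]; simp
  have h1 := h1 _ hpos ltU.le
  have h2 := h2 _ ltU
  rw [eU, hl, eV] at h1 h2
  have take : ∀ {W : FreeSemigroup B} {u w : List B} {a x : B}, letters W = u ++ a :: x :: w →
      letter W (u.length + 1) = a ∧ letter W (u.length + 1 + 1) = x ∧
      (IG.mk (subword W 1 (u.length + 1)) : WithOne (IG B)) = wprod gen (u ++ [a]) ∧
      (IG.mk (subword W (u.length + 1 + 1) W.length) : WithOne (IG B)) = wprod gen (x :: w) := by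
    intro W u w a x hW
    have hlen : W.length = u.length + 2 + w.length := by
      rw [← length_letters, hW]; simp; omega
    refine ⟨letter_of_eq_append hW, ?_, ?_, ?_⟩
    · have := letter_of_eq_append (w := W) (u := u ++ [a]) (x := x) (v := w) (by simp [hW])
      simpa using this
    · rw [mk_subword_left (by omega) (by omega), hW, take_length_succ]
    · rw [mk_subword_right (by omega), hW, drop_length_succ]
  obtain ⟨u1, u2, u3, u4⟩ := take hU
  obtain ⟨v1, v2, v3, v4⟩ := take hV
  rw [← u3, ← u4, ← v3, ← v4, WithOne.coe_inj, WithOne.coe_inj]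
  rw [u1, v1] at h1
  rw [u2, v2] at h2
  exact ⟨fun e => h1 (e ▸ rfl), fun e => h2 (e ▸ rfl)⟩

theorem IsLocallyLarge.conditionP (hB : IsLocallyLarge B) : ConditionP B := by
  intro u v hu hv h r i l hi hl
  rw [isAlmostNormal_iff] at hu hv
  obtain ⟨ru, hi⟩ := hi.unique hu
  obtain ⟨rv, hl⟩ := hl.unique hv
  have Hu := countsBlocks hu
  have Hv := countsBlocks hv
  -- Interior cuts fall between blocks of incomparable level. The extreme cases `s = r` and `t = 0`
  -- concern the whole words.
  have key : ∀ s, 1 ≤ s → s < r → IG.mk (subword u 1 (i s)) = IG.mk (subword v 1 (l s)) ∧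
      IG.mk (subword u (i s + 1) u.length) = IG.mk (subword v (l s + 1) v.length) := by
    intro s h1 h2
    rw [← WithOne.coe_inj, coe_mk, coe_mk] at h
    change wprod gen (letters u) = wprod gen (letters v) at h
    rw [hi s h2.le, hl s h2.le]
    obtain ⟨s, rfl⟩ : ∃ t, s = t + 1 := ⟨s - 1, by omega⟩
    have iu := Hu.incomp (s := s) (by omega) (Hu.blockEnd_lt (by omega))
    have iv := Hv.incomp (s := s) (by omega) (Hv.blockEnd_lt (by omega))
    have cu := Hu.count_blockEnd (s := s + 1) (by omega)
    have cv := Hv.count_blockEnd (s := s + 1) (by omega)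
    have pu := Hu.blockEnd_pos (s := s) (by omega)
    have pv := Hv.blockEnd_pos (s := s) (by omega)
    have lu := Hu.blockEnd_lt (s := s + 1) (by omega)
    have lv := Hv.blockEnd_lt (s := s + 1) (by omega)
    obtain ⟨w, w', e1, e2, e3⟩ := exists_split pu lu
    obtain ⟨z, z', e4, e5, e6⟩ := exists_split pv lv
    refine (and_congr WithOne.coe_inj WithOne.coe_inj).1 ?_
    rw [mk_subword_left pu lu.le, mk_subword_left pv lv.le, mk_subword_right lu, mk_subword_right lv, e2, e3, e5, e6]
    rw [e1] at hu h
    rw [e4] at hv h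
    rw [blockCount, e2] at cu
    rw [blockCount, e5] at cv
    exact hB.split hu hv (fun e => iu.1 e.le) (fun e => iv.1 e.le) h (cu.trans cv.symm)
  have full : ∀ w : FreeSemigroup B, IG.mk (subword w 1 w.length) = IG.mk w := by
    intro w
    rw [← WithOne.coe_inj, mk_subword_left (p := w.length) (Nat.succ_pos _) le_rfl, coe_mk,
      List.take_of_length_le (length_letters w).le]
    rfl
  constructor
  · intro s h1 h2 _
    rcases h2.lt_or_eq with h2 | rfl
    · exact (key s h1 h2).1
    · have eu := hi s le_rfl
      have ev := hl s le_rfl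
      rw [ru, CountsBlocks.blockEnd_last, ← ru] at eu
      rw [rv, CountsBlocks.blockEnd_last, ← rv] at ev
      rw [eu, ev, full, full, h]
  · intro t ht _
    rcases Nat.eq_zero_or_pos t with rfl | h1
    · rw [hi 0 ht.le, hl 0 ht.le, Hu.blockEnd_zero, Hv.blockEnd_zero, zero_add, full, full, h]
    · exact (key t h1 ht).2

theorem rStar_bar (hB : IsNormalBand B ∨ IsLocallyLarge B) (hS : SplitsAtLetters B)
    {w : FreeSemigroup B} (hw : List.IsChain (Adj comp) (letters w)) :
    RStar (IG.mk w) (IG.bar (letter w 1)) := by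
  intro p q
  obtain ⟨p, rfl⟩ := exists_wprod_eq p
  obtain ⟨q, rfl⟩ := exists_wprod_eq q
  rw [coe_mk]
  change _ ↔ _ * gen w.head = _ * gen w.head
  refine ⟨(reducible_gen hB hS).mul_right_cancel hw, fun h => ?_⟩
  rw [wprod_cons, ← gen_mul_self, mul_assoc, ← mul_assoc, h]
  simp only [mul_assoc]

theorem lStar_bar (hB : IsNormalBand B ∨ IsLocallyLarge B) (hS : SplitsAtLetters B)
    {w : FreeSemigroup B} (hw : List.IsChain (Adj comp) (letters w)) :
    LStar (IG.mk w) (IG.bar (letter w w.length)) := by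
  intro p q
  obtain ⟨p, rfl⟩ := exists_wprod_eq p
  obtain ⟨q, rfl⟩ := exists_wprod_eq q
  obtain ⟨u, x, e⟩ := (List.eq_nil_or_concat' (letters w)).resolve_left (List.cons_ne_nil _ _)
  have ex : letter w w.length = x := by
    rw [← length_letters, e, List.length_append, List.length_singleton]
    exact letter_of_eq_append e
  rw [coe_mk, ex]
  change wprod gen (letters w) * _ = wprod gen (letters w) * _ ↔ gen x * _ = gen x * _
  rw [e] at hw ⊢
  constructor
  · intro h
    have hw' := isChain_reverse hw
    rw [List.reverse_append, List.reverse_singleton, List.singleton_append] at hw'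
    -- Left cancellation in `IG(B)¹` is right cancellation in its opposite, applied to reversed
    -- words.
    have := (reducible_genOp hB hS).mul_right_cancel (p := p.reverse) (q := q.reverse) hw' (by
      simp only [wprod_genOp, List.reverse_reverse, List.reverse_cons, ← MulOpposite.op_mul]
      rw [h])
    simp only [wprod_genOp, List.reverse_reverse, genOp, ← MulOpposite.op_mul] at this
    exact MulOpposite.op_injective this
  · intro h
    rw [wprod_append, wprod_cons, wprod_nil, mul_one, mul_assoc, h, mul_assoc]

theorem isIdempotentElem_bar (x : B) : IsIdempotentElem (IG.bar x) := by
  rw [IsIdempotentElem, IG.bar_mul (isBasic_iff.2 (Or.inl (Band.mul_self x))), Band.mul_self]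

theorem isAbundant_of_splitsAtLetters (hB : IsNormalBand B ∨ IsLocallyLarge B)
    (hS : SplitsAtLetters B) : IsAbundant (IG B) := by
  intro a
  obtain ⟨w, rfl⟩ : ∃ w, IG.mk w = a := Quotient.exists_rep a
  obtain ⟨u, hu, e, hne⟩ := (reducible_gen hB hS).exists_isChain (letters w)
  obtain ⟨w', rfl⟩ := exists_letters_eq (hne (List.cons_ne_nil _ _))
  have : IG.mk w = IG.mk w' := by
    rw [← WithOne.coe_inj, coe_mk, coe_mk]
    exact e.symm
  rw [this]
  exact ⟨⟨_, isIdempotentElem_bar _, lStar_bar hB hS hu⟩,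
    ⟨_, isIdempotentElem_bar _, rStar_bar hB hS hu⟩⟩

end Main

end FreeIG

open FreeIG
theorem mainTheorem2 {B : Type*} [Band B] :
    (ConditionP B → IsNormalBand B ∨ IsLocallyLarge B →
      IsAbundant (IG B) ∧
      ∀ w : FreeSemigroup B, IsAlmostNormal w →
        RStar (IG.mk w) (IG.bar (letter w 1)) ∧ LStar (IG.mk w) (IG.bar (letter w w.length))) ∧
    (IsLocallyLarge B → ConditionP B) ∧
    (IsLocallyLarge B → IsAbundant (IG B)) := by
  refine ⟨fun hP hB => ⟨isAbundant_of_splitsAtLetters hB hP.splitsAtLetters, fun w hw => ?_⟩,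
    fun hB => hB.conditionP, fun hB =>
      isAbundant_of_splitsAtLetters (Or.inr hB) hB.conditionP.splitsAtLetters⟩
  have hw := isAlmostNormal_iff.1 hw
  exact ⟨rStar_bar hB hP.splitsAtLetters hw, lStar_bar hB hP.splitsAtLetters hw⟩
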